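/- Let $n\ge 1$, $2\le q\le 4$, $-n<p<0$, $m>0$ and $M>0$. Let $\|\cdot\|$ be the Euclidean norm on $\mathbb{R}^n$, put $$K(x)=\frac{\|x\|^q}{q}-\frac{\|x\|^p}{p},\qquad E(u)=\int_{\mathbb{R}^n\times\mathbb{R}^n}K(x-y)\,u(x)\,u(y)\,dx\,dy\in[0,\infty],$$ and let $$\mathcal{A}=\Big\{u\in L^1(\mathbb{R}^n)\cap L^\infty(\mathbb{R}^n):\ 0\le u\le M \text{ a.e.},\ \int_{\mathbb{R}^n}u\,dx=m\Big\}.$$ Then the minimizer of $E$ on $\mathcal{A}$ is unique up to translation: if $u,v\in\mathcal{A}$ both minimize $E$ on $\mathcal{A}$, then there is $a\in\mathbb{R}^n$ with $v(x)=u(x-a)$ for almost every $x$. Moreover, every minimizer $u$ is radially symmetric about its center of mass: the function $x\mapsto u(x)\,x$ is integrable, and with $c=\frac1m\int_{\mathbb{R}^n}u(x)\,x\,dx$ there is a function $f:\mathbb{R}\to\mathbb{R}$ with $u(x)=f(\|x-c\|)$ for almost every $x$. In particular, a minimizer with center of mass $0$ is radially symmetric about the origin. -/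

import Mathlib

open MeasureTheory

namespace NonlocalMin

/-- The interaction kernel `K(x) = ‖x‖^q / q - ‖x‖^p / p` on `ℝⁿ`. For `p < 0` its value at the
single point `x = 0` is immaterial: `K (x - y)` is only integrated over `ℝⁿ × ℝⁿ`, `n ≥ 1`. -/
noncomputable def kernel {n : ℕ} (p q : ℝ) (x : EuclideanSpace ℝ (Fin n)) : ℝ :=
  ‖x‖ ^ q / q - ‖x‖ ^ p / p

/-- For `p < 0 < q` the kernel is nonnegative. -/
theorem kernel_nonneg {n : ℕ} {p q : ℝ} (hp : p < 0) (hq : 0 < q)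
    (x : EuclideanSpace ℝ (Fin n)) : 0 ≤ kernel p q x := by
  have h1 : 0 ≤ ‖x‖ ^ q / q := div_nonneg (Real.rpow_nonneg (norm_nonneg x) q) hq.le
  have h2 : ‖x‖ ^ p / p ≤ 0 :=
    div_nonpos_of_nonneg_of_nonpos (Real.rpow_nonneg (norm_nonneg x) p) hp.le
  unfold kernel
  linarith

/-- The admissible set: integrable `u` on `ℝⁿ` with `0 ≤ u ≤ M` almost everywhere and total
mass `m`. Elements are functions; the classes of `L¹ ∩ L^∞` are obtained by identifying functions
that agree almost everywhere. -/
def admissible (n : ℕ) (m M : ℝ) : Set (EuclideanSpace ℝ (Fin n) → ℝ) :=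
  {u | Integrable u ∧ (∀ᵐ x, 0 ≤ u x) ∧ (∀ᵐ x, u x ≤ M) ∧ ∫ x, u x = m}

/-- The energy `E(u) = ∬ K(x - y) u(x) u(y) dx dy`. For `p < 0 < q` and admissible `u` the
integrand is nonnegative almost everywhere, so that the integral always makes sense with values
in `[0, ∞]`; the value `∞` is attained, for instance when `u` has no finite moment of order `q`. -/
noncomputable def energy {n : ℕ} (p q : ℝ) (u : EuclideanSpace ℝ (Fin n) → ℝ) : ENNReal :=
  ∫⁻ z : EuclideanSpace ℝ (Fin n) × EuclideanSpace ℝ (Fin n),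
    ENNReal.ofReal (kernel p q (z.1 - z.2) * u z.1 * u z.2)

/-- `u` minimizes the energy over the admissible set. -/
def IsMinimizer {n : ℕ} (p q m M : ℝ) (u : EuclideanSpace ℝ (Fin n) → ℝ) : Prop :=
  u ∈ admissible n m M ∧ ∀ w ∈ admissible n m M, energy p q u ≤ energy p q w

/-- `u` is (almost everywhere equal to) a function of the distance to `c`. -/
def IsRadialAbout {n : ℕ} (c : EuclideanSpace ℝ (Fin n)) (u : EuclideanSpace ℝ (Fin n) → ℝ) :
    Prop :=
  ∃ f : ℝ → ℝ, ∀ᵐ x, u x = f ‖x - c‖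

end NonlocalMin

/-! The energy is the diagonal of a quadratic form `Q`. For admissible `u`, `v` the midpoint `w` is
admissible, and `E(w) + Q(u - v)/4 = (E(u) + E(v))/2`. If both are minimizers, then `Q(u - v) ≤ 0`,
so uniqueness reduces to `Q` being positive definite on differences of minimizers. These have zero
mass and, once both centers of mass are translated to the origin, zero first moment
(`IsMinimizer.ae_eq_of_moment_eq`).

Positive definiteness rests on Gaussians: the form of `exp (-t r²)` is a positive multiple of the
squared `L²` norm of a smoothing. The power `r^p` with `p < 0` is a positive mixture of Gaussians,
hence gives a nonnegative form; if that form vanishes on `η`, arbitrarily sharp Gaussian smoothings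
of `η` vanish and `η = 0`. For `2 < q < 4`, `r^q` is a positive mixture of `exp (-t r²) - 1 + t r²`;
zero mass and zero first moment kill the last two terms, so this form is nonnegative too. At `q = 2`
it is zero, and `q = 4` is a limit.

Radial symmetry follows from uniqueness: a centered minimizer composed with a linear isometry is
again a centered minimizer, hence the same function almost everywhere. -/

namespace NonlocalMin

open Filter Topology Real Set

/-! ### Mixtures of kernels and the Gaussian interaction form -/

/-- A weight `ρ` that is integrable against `K = ∫ k(·, t) dν(t)`, where `k ≥ 0`, is jointly
integrable against `k`. -/
theorem integrable_mixture {X T : Type*} [MeasurableSpace X] [MeasurableSpace T]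
    {μ : Measure X} {ν : Measure T} [SFinite μ] [SFinite ν] {k : X → T → ℝ} {K ρ : X → ℝ}
    (hk : Measurable (Function.uncurry k)) (hk0 : ∀ x, ∀ᵐ t ∂ν, 0 ≤ k x t)
    (hkint : ∀ᵐ x ∂μ, Integrable (k x) ν) (hK : ∀ᵐ x ∂μ, ∫ t, k x t ∂ν = K x)
    (hρ : AEStronglyMeasurable ρ μ) (hKρ : Integrable (fun x => K x * ρ x) μ) :
    Integrable (Function.uncurry fun x t => k x t * ρ x) (μ.prod ν) := by
  have hm : AEStronglyMeasurable (Function.uncurry fun x t => k x t * ρ x) (μ.prod ν) :=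
    hk.aestronglyMeasurable.mul hρ.comp_fst
  refine (integrable_prod_iff hm).2 ⟨?_, ?_⟩
  · filter_upwards [hkint] with x hx
    exact hx.mul_const (ρ x)
  · refine hKρ.norm.congr ?_
    filter_upwards [hK] with x hx
    have h1 : ∀ᵐ t ∂ν, ‖Function.uncurry (fun x t => k x t * ρ x) (x, t)‖ = k x t * ‖ρ x‖ := by
      filter_upwards [hk0 x] with t ht
      simp [abs_of_nonneg ht]
    rw [integral_congr_ae h1, integral_mul_const, hx, norm_mul, Real.norm_of_nonneg]
    rw [← hx]
    exact integral_nonneg_of_ae (hk0 x)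

/-- The parallelogram law completes the square in `z`: the product is a Gaussian in `x - y` times
one in `z` centered at the midpoint, so integrating out `z` leaves the Gaussian kernel. -/
theorem gaussian_mul_gaussian {V : Type*} [NormedAddCommGroup V] [InnerProductSpace ℝ V] (t : ℝ)
    (x y z : V) :
    rexp (-(2 * t) * ‖x - z‖ ^ 2) * rexp (-(2 * t) * ‖y - z‖ ^ 2) =
      rexp (-t * ‖x - y‖ ^ 2) * rexp (-(4 * t) * ‖z - (2⁻¹ : ℝ) • (x + y)‖ ^ 2) := by
  rw [← Real.exp_add, ← Real.exp_add]
  congr 1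
  have h := parallelogram_law_with_norm ℝ (x - z) (y - z)
  have h1 : x - z + (y - z) = (-2 : ℝ) • (z - (2⁻¹ : ℝ) • (x + y)) := by module
  have h2 : x - z - (y - z) = x - y := by abel
  have h3 : ‖(-2 : ℝ)‖ = 2 := by norm_num
  rw [h1, h2, norm_smul, h3] at h
  linear_combination (t) * h

section GaussianForm

variable {V : Type*} [NormedAddCommGroup V] [InnerProductSpace ℝ V] [FiniteDimensional ℝ V]
  [MeasurableSpace V] [BorelSpace V]

theorem integrable_rexp_neg_mul_sq_norm {b : ℝ} (hb : 0 < b) :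
    Integrable fun v : V => rexp (-b * ‖v‖ ^ 2) := by
  -- A non-integrable function has Bochner integral `0`, so a nonzero value proves integrability.
  refine Integrable.of_integral_ne_zero ?_
  rw [GaussianFourier.integral_rexp_neg_mul_sq_norm hb]
  positivity

theorem integrable_gaussian_mul_gaussian {t : ℝ} (ht : 0 < t) (x y : V) :
    Integrable fun z : V => rexp (-(2 * t) * ‖x - z‖ ^ 2) * rexp (-(2 * t) * ‖y - z‖ ^ 2) := by
  simp_rw [gaussian_mul_gaussian]
  exact ((integrable_rexp_neg_mul_sq_norm (V := V) (b := 4 * t)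
    (by positivity)).comp_sub_right _).const_mul _

theorem integral_gaussian_mul_gaussian {t : ℝ} (ht : 0 < t) (x y : V) :
    ∫ z : V, rexp (-(2 * t) * ‖x - z‖ ^ 2) * rexp (-(2 * t) * ‖y - z‖ ^ 2) =
      (π / (4 * t)) ^ (Module.finrank ℝ V / 2 : ℝ) * rexp (-t * ‖x - y‖ ^ 2) := by
  simp_rw [gaussian_mul_gaussian]
  rw [integral_const_mul, integral_sub_right_eq_self (fun z : V => rexp (-(4 * t) * ‖z‖ ^ 2)),
    GaussianFourier.integral_rexp_neg_mul_sq_norm (by positivity), mul_comm]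

theorem integrable_gaussian_mul_prod {t : ℝ} (ht : 0 ≤ t) {η : V → ℝ} (hη : Integrable η) :
    Integrable fun z : V × V => rexp (-t * ‖z.1 - z.2‖ ^ 2) * (η z.1 * η z.2) := by
  refine (hη.mul_prod hη).bdd_mul (c := 1) (by fun_prop) (ae_of_all _ fun z => ?_)
  rw [Real.norm_eq_abs, abs_of_pos (Real.exp_pos _), Real.exp_le_one_iff]
  nlinarith [sq_nonneg ‖z.1 - z.2‖]

theorem integrable_gaussian_triple {t : ℝ} (ht : 0 < t) {η : V → ℝ} (hη : Integrable η) :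
    Integrable (Function.uncurry fun (w : V × V) (z : V) =>
      rexp (-(2 * t) * ‖w.1 - z‖ ^ 2) * rexp (-(2 * t) * ‖w.2 - z‖ ^ 2) * (η w.1 * η w.2))
      ((volume : Measure (V × V)).prod volume) := by
  refine integrable_mixture
    (K := fun w => (π / (4 * t)) ^ (Module.finrank ℝ V / 2 : ℝ) * rexp (-t * ‖w.1 - w.2‖ ^ 2))
    ?_ ?_ ?_ ?_ ?_ ?_
  · have : Continuous (Function.uncurry fun (w : V × V) (z : V) =>
      rexp (-(2 * t) * ‖w.1 - z‖ ^ 2) * rexp (-(2 * t) * ‖w.2 - z‖ ^ 2)) := by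
      unfold Function.uncurry
      fun_prop
    exact this.measurable
  · exact fun w => ae_of_all _ fun z => by positivity
  · exact ae_of_all _ fun w => integrable_gaussian_mul_gaussian ht _ _
  · exact ae_of_all _ fun w => integral_gaussian_mul_gaussian ht _ _
  · exact (hη.mul_prod hη).aestronglyMeasurable
  · simp_rw [mul_assoc]
    exact (integrable_gaussian_mul_prod ht.le hη).const_mul _

theorem integral_gaussian_triple (t : ℝ) (η : V → ℝ) (z : V) :
    ∫ w : V × V, rexp (-(2 * t) * ‖w.1 - z‖ ^ 2) * rexp (-(2 * t) * ‖w.2 - z‖ ^ 2) *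
      (η w.1 * η w.2) = (∫ x, rexp (-(2 * t) * ‖x - z‖ ^ 2) * η x) ^ 2 := by
  rw [sq, ← integral_prod_mul, Measure.volume_eq_prod]
  exact integral_congr_ae (ae_of_all _ fun w => by ring)

theorem integrable_sq_gaussian_smoothing {t : ℝ} (ht : 0 < t) {η : V → ℝ} (hη : Integrable η) :
    Integrable fun z => (∫ x, rexp (-(2 * t) * ‖x - z‖ ^ 2) * η x) ^ 2 := by
  have h := (integrable_gaussian_triple ht hη).integral_prod_right
  simpa only [Function.uncurry, integral_gaussian_triple] using h

/-- The Gaussian energy is, up to a positive factor, the squared `L²` norm of a smoothing. -/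
theorem integral_gaussian_mul_prod {t : ℝ} (ht : 0 < t) {η : V → ℝ} (hη : Integrable η) :
    (π / (4 * t)) ^ (Module.finrank ℝ V / 2 : ℝ) *
        ∫ w : V × V, rexp (-t * ‖w.1 - w.2‖ ^ 2) * (η w.1 * η w.2) =
      ∫ z, (∫ x, rexp (-(2 * t) * ‖x - z‖ ^ 2) * η x) ^ 2 := by
  have h := integral_integral_swap (integrable_gaussian_triple ht hη)
  simp_rw [integral_gaussian_triple, integral_mul_const,
    integral_gaussian_mul_gaussian ht] at h
  rw [← h, ← integral_const_mul]
  simp_rw [mul_assoc]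

theorem integral_gaussian_mul_prod_nonneg {t : ℝ} (ht : 0 < t) {η : V → ℝ} (hη : Integrable η) :
    0 ≤ ∫ w : V × V, rexp (-t * ‖w.1 - w.2‖ ^ 2) * (η w.1 * η w.2) := by
  have h := integral_gaussian_mul_prod ht hη
  have h1 : 0 ≤ ∫ z, (∫ x, rexp (-(2 * t) * ‖x - z‖ ^ 2) * η x) ^ 2 :=
    integral_nonneg fun z => sq_nonneg _
  rw [← h] at h1
  exact (mul_nonneg_iff_of_pos_left (by positivity)).1 h1

theorem gaussian_smoothing_ae_eq_zero {t : ℝ} (ht : 0 < t) {η : V → ℝ} (hη : Integrable η)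
    (h0 : ∫ w : V × V, rexp (-t * ‖w.1 - w.2‖ ^ 2) * (η w.1 * η w.2) = 0) :
    ∀ᵐ z, ∫ x, rexp (-(2 * t) * ‖x - z‖ ^ 2) * η x = 0 := by
  have h := integral_gaussian_mul_prod ht hη
  rw [h0, mul_zero, eq_comm, integral_eq_zero_iff_of_nonneg (fun z => sq_nonneg _)
    (integrable_sq_gaussian_smoothing ht hη)] at h
  filter_upwards [h] with z hz
  simpa using hz

/-- Real part of the complex-valued approximate identity; the prefactor normalizes the Gaussian to
mass one. -/
theorem tendsto_integral_gaussian_real {g : V → ℝ} (hg : Integrable g) (hc : Continuous g)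
    (v : V) :
    Tendsto (fun c : ℝ => ∫ w, (π * c) ^ (Module.finrank ℝ V / 2 : ℝ) *
      rexp (-(π ^ 2 * c) * ‖v - w‖ ^ 2) * g w) atTop (𝓝 (g v)) := by
  have h := Real.tendsto_integral_gaussian_smul' (f := fun v => (g v : ℂ)) hg.ofReal (v := v)
    (by fun_prop)
  have h2 := (Complex.continuous_re.tendsto _).comp h
  rw [Complex.ofReal_re] at h2
  refine h2.congr' ?_
  filter_upwards [eventually_gt_atTop 0] with c hc
  have : ∀ w : V, ((π : ℂ) * c) ^ ((Module.finrank ℝ V : ℂ) / 2) *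
      Complex.exp (-π ^ 2 * c * ‖v - w‖ ^ 2) • (g w : ℂ) =
      (((π * c) ^ (Module.finrank ℝ V / 2 : ℝ) *
        rexp (-(π ^ 2 * c) * ‖v - w‖ ^ 2) * g w : ℝ) : ℂ) := by
    intro w
    rw [smul_eq_mul]
    push_cast
    rw [Complex.ofReal_cpow (by positivity)]
    push_cast
    ring_nf
  simp only [Function.comp, smul_eq_mul, mul_assoc] at this ⊢
  simp_rw [this]
  rw [integral_complex_ofReal, Complex.ofReal_re]

/-- An integrable function all of whose Gaussian smoothings vanish is zero. -/
theorem ae_eq_zero_of_gaussian_smoothing {η : V → ℝ} (hη : Integrable η)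
    (h : ∃ᶠ c in atTop, ∀ᵐ z, ∫ x, rexp (-c * ‖x - z‖ ^ 2) * η x = 0) : ∀ᵐ x, η x = 0 := by
  refine ae_eq_zero_of_integral_contDiff_smul_eq_zero hη.locallyIntegrable fun g hgs hgc => ?_
  have hcont := hgs.continuous
  have hgi : Integrable g := hcont.integrable_of_hasCompactSupport hgc
  obtain ⟨C, hC⟩ := hcont.bounded_above_of_compact_support hgc
  -- Smoothing the test function `g` by a Gaussian of mass one keeps it bounded by `C`, so `C * ‖η‖`
  -- dominates.
  have hlim : Tendsto (fun c : ℝ => ∫ v, (∫ w, (π * c) ^ (Module.finrank ℝ V / 2 : ℝ) *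
      rexp (-(π ^ 2 * c) * ‖v - w‖ ^ 2) * g w) * η v) atTop (𝓝 (∫ v, g v * η v)) := by
    refine tendsto_integral_filter_of_dominated_convergence (fun v => C * ‖η v‖) ?_ ?_
      (hη.norm.const_mul C) (ae_of_all _ fun v => ?_)
    · refine Eventually.of_forall fun c => ?_
      refine AEStronglyMeasurable.mul ?_ hη.aestronglyMeasurable
      refine StronglyMeasurable.aestronglyMeasurable ?_
      refine StronglyMeasurable.integral_prod_right
        (f := fun v w : V => (π * c) ^ (Module.finrank ℝ V / 2 : ℝ) *
          rexp (-(π ^ 2 * c) * ‖v - w‖ ^ 2) * g w) ?_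
      unfold Function.uncurry
      exact Continuous.stronglyMeasurable (by fun_prop)
    · filter_upwards [eventually_gt_atTop 0] with c hc
      refine ae_of_all _ fun v => ?_
      rw [norm_mul]
      refine mul_le_mul_of_nonneg_right ?_ (norm_nonneg _)
      have hgauss : ∫ w : V, (π * c) ^ (Module.finrank ℝ V / 2 : ℝ) *
          rexp (-(π ^ 2 * c) * ‖v - w‖ ^ 2) = 1 := by
        rw [integral_const_mul,
          integral_sub_left_eq_self (fun z : V => rexp (-(π ^ 2 * c) * ‖z‖ ^ 2)),
          GaussianFourier.integral_rexp_neg_mul_sq_norm (by positivity),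
          ← Real.mul_rpow (by positivity) (by positivity)]
        have : π * c * (π / (π ^ 2 * c)) = 1 := by field_simp
        rw [this, Real.one_rpow]
      have hgi' : Integrable fun w : V => (π * c) ^ (Module.finrank ℝ V / 2 : ℝ) *
          rexp (-(π ^ 2 * c) * ‖v - w‖ ^ 2) := .of_integral_ne_zero (by rw [hgauss]; simp)
      calc _ ≤ ∫ w : V, (π * c) ^ (Module.finrank ℝ V / 2 : ℝ) *
          rexp (-(π ^ 2 * c) * ‖v - w‖ ^ 2) * C := by
            refine norm_integral_le_of_norm_le (hgi'.mul_const C) (ae_of_all _ fun w => ?_)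
            rw [norm_mul, Real.norm_of_nonneg (by positivity)]
            exact mul_le_mul_of_nonneg_left (hC w) (by positivity)
        _ = C := by rw [integral_mul_const, hgauss, one_mul]
    · exact (tendsto_integral_gaussian_real hgi hcont v).mul_const _
  -- Fubini moves the smoothing from `g` onto `η`, where it vanishes for the given `c`.
  have hfreq : ∃ᶠ c : ℝ in atTop, ∫ v, (∫ w, (π * c) ^ (Module.finrank ℝ V / 2 : ℝ) *
      rexp (-(π ^ 2 * c) * ‖v - w‖ ^ 2) * g w) * η v = 0 := by
    have h' : ∃ᶠ c : ℝ in atTop, ∀ᵐ z, ∫ x, rexp (-(π ^ 2 * c) * ‖x - z‖ ^ 2) * η x = 0 := by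
      have hmap : map (fun c : ℝ => π ^ 2 * c) atTop = atTop :=
        (OrderIso.mulLeft₀ (π ^ 2) (by positivity)).map_atTop
      rw [← hmap] at h
      exact h
    refine (h'.and_eventually (eventually_gt_atTop 0)).mono fun c ⟨hc, hc0⟩ => ?_
    have hint : Integrable (Function.uncurry fun v w : V =>
        rexp (-(π ^ 2 * c) * ‖v - w‖ ^ 2) * (η v * g w)) (volume.prod volume) := by
      refine (hη.mul_prod hgi).bdd_mul (c := 1)
        (f := fun z : V × V => rexp (-(π ^ 2 * c) * ‖z.1 - z.2‖ ^ 2)) ?_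
        (ae_of_all _ fun z => ?_)
      · exact Continuous.aestronglyMeasurable (by fun_prop)
      · rw [Real.norm_eq_abs, abs_of_pos (Real.exp_pos _), Real.exp_le_one_iff]
        have : 0 ≤ π ^ 2 * c * ‖z.1 - z.2‖ ^ 2 := by positivity
        linarith
    have hswap := integral_integral_swap hint
    have hzero : ∫ w, ∫ v, rexp (-(π ^ 2 * c) * ‖v - w‖ ^ 2) * (η v * g w) = 0 := by
      refine integral_eq_zero_of_ae ?_
      filter_upwards [hc] with w hw
      simp_rw [← mul_assoc]
      rw [integral_mul_const, hw]
      simp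
    rw [hzero] at hswap
    have : ∀ v, (∫ w, (π * c) ^ (Module.finrank ℝ V / 2 : ℝ) *
        rexp (-(π ^ 2 * c) * ‖v - w‖ ^ 2) * g w) * η v =
        (π * c) ^ (Module.finrank ℝ V / 2 : ℝ) *
          ∫ w, rexp (-(π ^ 2 * c) * ‖v - w‖ ^ 2) * (η v * g w) := by
      intro v
      rw [← integral_mul_const, ← integral_const_mul]
      exact integral_congr_ae (ae_of_all _ fun w => by ring)
    simp_rw [this]
    rw [integral_const_mul, hswap, mul_zero]
  -- The limit exists along all of `atTop`, so vanishing frequently already forces it to be zero.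
  by_contra hne
  simp only [smul_eq_mul] at hne
  exact hfreq (hlim.eventually_ne hne)

end GaussianForm

/-! ### Powers of the distance as mixtures of Gaussians -/

theorem integral_rpow_mul_gaussian {p r : ℝ} (hp : p < 0) (hr : 0 < r) :
    ∫ t in Ioi 0, t ^ (-p / 2 - 1) * rexp (-t * r ^ 2) = Real.Gamma (-p / 2) * r ^ p := by
  have h := Real.integral_rpow_mul_exp_neg_mul_Ioi (a := -p / 2) (r := r ^ 2) (by linarith)
    (by positivity)
  have h1 : (1 / r ^ 2) ^ (-p / 2) = r ^ p := by
    rw [one_div, ← Real.rpow_natCast, ← Real.rpow_neg hr.le, ← Real.rpow_mul hr.le]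
    congr 1
    push_cast
    ring
  rw [h1] at h
  rw [mul_comm, ← h]
  congr! 4 with t
  ring

theorem integrableOn_rpow_mul_gaussian {p r : ℝ} (hp : p < 0) (hr : 0 < r) :
    IntegrableOn (fun t => t ^ (-p / 2 - 1) * rexp (-t * r ^ 2)) (Ioi 0) := by
  refine Integrable.of_integral_ne_zero ?_
  rw [integral_rpow_mul_gaussian hp hr]
  have := Real.Gamma_pos_of_pos (s := -p / 2) (by linarith)
  positivity

theorem exp_neg_sub_one_add_le_sq {s : ℝ} (hs : 0 ≤ s) : rexp (-s) - 1 + s ≤ s ^ 2 := by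
  have h := Real.add_one_le_exp s
  have h2 : rexp (-s) ≤ (s + 1)⁻¹ := by
    rw [Real.exp_neg]
    exact inv_anti₀ (by positivity) h
  have h3 : (s + 1)⁻¹ ≤ 1 - s + s ^ 2 := by
    rw [inv_le_iff_one_le_mul₀ (by positivity)]
    nlinarith [pow_nonneg hs 3]
  linarith

theorem exp_neg_sub_one_add_nonneg (s : ℝ) : 0 ≤ rexp (-s) - 1 + s := by
  linarith [Real.add_one_le_exp (-s)]

/-- Near `0` the remainder is at most `s ^ 2`, leaving `s ^ (1 - q / 2)`, which needs `q < 4`. On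
`(1, ∞)` it is at most `s`, leaving `s ^ (-q / 2)`, which needs `q > 2`. -/
theorem integrableOn_rpow_mul_exp_remainder {q : ℝ} (hq2 : 2 < q) (hq4 : q < 4) :
    IntegrableOn (fun s => s ^ (-q / 2 - 1) * (rexp (-s) - 1 + s)) (Ioi 0) := by
  have hm : Measurable fun s : ℝ => s ^ (-q / 2 - 1) * (rexp (-s) - 1 + s) := by fun_prop
  rw [← Ioc_union_Ioi_eq_Ioi zero_le_one, integrableOn_union]
  constructor
  · have h : IntegrableOn (fun s : ℝ => s ^ (1 - q / 2)) (Ioc 0 1) := by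
      rw [← intervalIntegrable_iff_integrableOn_Ioc_of_le zero_le_one]
      exact intervalIntegral.intervalIntegrable_rpow' (by linarith)
    refine Integrable.mono' h hm.aestronglyMeasurable ?_
    filter_upwards [ae_restrict_mem measurableSet_Ioc] with s hs
    have hs0 : 0 < s := hs.1
    rw [Real.norm_of_nonneg (mul_nonneg (by positivity) (exp_neg_sub_one_add_nonneg s))]
    calc _ ≤ s ^ (-q / 2 - 1) * s ^ 2 :=
          mul_le_mul_of_nonneg_left (exp_neg_sub_one_add_le_sq hs0.le) (by positivity)
      _ = s ^ (1 - q / 2) := by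
          rw [← Real.rpow_natCast, ← Real.rpow_add hs0]
          congr 1
          push_cast
          ring
  · have h : IntegrableOn (fun s : ℝ => s ^ (-q / 2)) (Ioi 1) :=
      integrableOn_Ioi_rpow_of_lt (by linarith) zero_lt_one
    refine Integrable.mono' h hm.aestronglyMeasurable ?_
    filter_upwards [ae_restrict_mem measurableSet_Ioi] with s hs
    have hs0 : 0 < s := zero_lt_one.trans hs
    rw [Real.norm_of_nonneg (mul_nonneg (by positivity) (exp_neg_sub_one_add_nonneg s))]
    calc _ ≤ s ^ (-q / 2 - 1) * s := by
          refine mul_le_mul_of_nonneg_left ?_ (by positivity)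
          have : rexp (-s) ≤ 1 := Real.exp_le_one_iff.2 (by linarith)
          linarith
      _ = s ^ (-q / 2) := by
          rw [← Real.rpow_add_one hs0.ne']
          congr 1
          ring

theorem integral_rpow_mul_exp_remainder_pos {q : ℝ} (hq2 : 2 < q) (hq4 : q < 4) :
    0 < ∫ s in Ioi 0, s ^ (-q / 2 - 1) * (rexp (-s) - 1 + s) := by
  have hpos : ∀ s ∈ Ioi (0 : ℝ), 0 < s ^ (-q / 2 - 1) * (rexp (-s) - 1 + s) := by
    intro s hs
    have hs0 : 0 < s := hs
    have := Real.add_one_lt_exp (x := -s) (by linarith)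
    exact mul_pos (by positivity) (by linarith)
  rw [setIntegral_pos_iff_support_of_nonneg_ae
    (by filter_upwards [ae_restrict_mem measurableSet_Ioi] with s hs using (hpos s hs).le)
    (integrableOn_rpow_mul_exp_remainder hq2 hq4)]
  have hsub : Ioi 0 ⊆ Function.support fun s => s ^ (-q / 2 - 1) * (rexp (-s) - 1 + s) :=
    fun s hs => (hpos s hs).ne'
  rw [inter_eq_right.2 hsub]
  simp

/-- Prepares the substitution `s = r² t`: its Jacobian `r⁻²` turns the factor `r ^ (q + 2)` into `r
^ q`. -/
theorem rpow_mul_exp_remainder_scale (q : ℝ) {r t : ℝ} (hr : 0 < r) (ht : 0 < t) :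
    t ^ (-q / 2 - 1) * (rexp (-t * r ^ 2) - 1 + t * r ^ 2) =
      r ^ (q + 2) * ((r ^ 2 * t) ^ (-q / 2 - 1) * (rexp (-(r ^ 2 * t)) - 1 + r ^ 2 * t)) := by
  rw [Real.mul_rpow (by positivity) ht.le, ← Real.rpow_natCast, ← Real.rpow_mul hr.le]
  have h : r ^ (q + 2) * r ^ (((2 : ℕ) : ℝ) * (-q / 2 - 1)) = 1 := by
    rw [← Real.rpow_add hr]
    have : q + 2 + ((2 : ℕ) : ℝ) * (-q / 2 - 1) = 0 := by push_cast; ring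
    rw [this, Real.rpow_zero]
  have h' : -t * r ^ ((2 : ℕ) : ℝ) = -(r ^ ((2 : ℕ) : ℝ) * t) := by ring
  rw [h']
  linear_combination (- t ^ (-q / 2 - 1) * (rexp (-(r ^ ((2 : ℕ) : ℝ) * t)) - 1 +
    t * r ^ ((2 : ℕ) : ℝ))) * h

theorem integrableOn_rpow_mul_exp_remainder_sq {q r : ℝ} (hq2 : 2 < q) (hq4 : q < 4)
    (hr : 0 ≤ r) :
    IntegrableOn (fun t => t ^ (-q / 2 - 1) * (rexp (-t * r ^ 2) - 1 + t * r ^ 2)) (Ioi 0) := by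
  rcases hr.eq_or_lt with rfl | hr
  · simp
  have h := (integrableOn_Ioi_comp_mul_left_iff
    (fun s => s ^ (-q / 2 - 1) * (rexp (-s) - 1 + s)) 0 (a := r ^ 2) (by positivity)).2
    (by simpa using integrableOn_rpow_mul_exp_remainder hq2 hq4)
  refine (h.const_mul (r ^ (q + 2))).congr ?_
  filter_upwards [ae_restrict_mem measurableSet_Ioi] with t ht
  exact (rpow_mul_exp_remainder_scale q hr ht).symm

theorem integral_rpow_mul_exp_remainder_sq {q r : ℝ} (hq2 : 2 < q) (hr : 0 ≤ r) :
    ∫ t in Ioi 0, t ^ (-q / 2 - 1) * (rexp (-t * r ^ 2) - 1 + t * r ^ 2) =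
      (∫ s in Ioi 0, s ^ (-q / 2 - 1) * (rexp (-s) - 1 + s)) * r ^ q := by
  rcases hr.eq_or_lt with rfl | hr
  · simp [Real.zero_rpow (by linarith : q ≠ 0)]
  rw [setIntegral_congr_fun measurableSet_Ioi
    fun t ht => rpow_mul_exp_remainder_scale q hr ht, integral_const_mul,
    integral_comp_mul_left_Ioi (fun s => s ^ (-q / 2 - 1) * (rexp (-s) - 1 + s)) 0
      (by positivity : 0 < r ^ 2), mul_zero, smul_eq_mul, ← mul_assoc, mul_comm]
  congr 1
  rw [← Real.rpow_natCast, ← Real.rpow_neg hr.le, ← Real.rpow_add hr]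
  congr 1
  push_cast
  ring

/-! ### Moment bounds -/

section Moments

variable {V : Type*} [NormedAddCommGroup V] [MeasurableSpace V] [BorelSpace V]
  {μ : Measure V}

theorem rpow_le_one_add_rpow {r s q : ℝ} (hr : 0 ≤ r) (hs : 0 ≤ s) (hsq : s ≤ q) :
    r ^ s ≤ 1 + r ^ q := by
  rcases le_total r 1 with h | h
  · have := Real.rpow_le_one hr h hs
    have := Real.rpow_nonneg hr q
    linarith
  · have := Real.rpow_le_rpow_of_exponent_le h hsq
    linarith

theorem norm_sub_rpow_le {V : Type*} [NormedAddCommGroup V] {q : ℝ} (hq : 0 ≤ q) (x y : V) :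
    ‖x - y‖ ^ q ≤ 2 ^ q * (‖x‖ ^ q + ‖y‖ ^ q) := by
  have h0 : ‖x - y‖ ≤ 2 * max ‖x‖ ‖y‖ := by
    linarith [norm_sub_le x y, le_max_left ‖x‖ ‖y‖, le_max_right ‖x‖ ‖y‖]
  have hm : 0 ≤ max ‖x‖ ‖y‖ := le_max_of_le_left (norm_nonneg x)
  calc ‖x - y‖ ^ q ≤ (2 * max ‖x‖ ‖y‖) ^ q := Real.rpow_le_rpow (norm_nonneg _) h0 hq
    _ = 2 ^ q * max ‖x‖ ‖y‖ ^ q := Real.mul_rpow (by norm_num) hm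
    _ ≤ _ := by
      refine mul_le_mul_of_nonneg_left ?_ (by positivity)
      have h1 := Real.rpow_nonneg (norm_nonneg x) q
      have h2 := Real.rpow_nonneg (norm_nonneg y) q
      rcases max_choice ‖x‖ ‖y‖ with h | h <;> rw [h] <;> linarith

theorem integrable_moment_of_le {η : V → ℝ} {s q : ℝ} (hη : Integrable η μ)
    (hq : Integrable (fun x => ‖x‖ ^ q * η x) μ) (hs : 0 ≤ s) (hsq : s ≤ q) :
    Integrable (fun x => ‖x‖ ^ s * η x) μ := by
  have hm : Measurable fun x : V => ‖x‖ ^ s := by fun_prop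
  refine (hη.norm.add hq.norm).mono' (hm.aestronglyMeasurable.mul hη.aestronglyMeasurable)
    (ae_of_all _ fun x => ?_)
  have h := rpow_le_one_add_rpow (norm_nonneg x) hs hsq
  simp only [norm_mul, Pi.add_apply, Real.norm_of_nonneg (Real.rpow_nonneg (norm_nonneg x) _)]
  nlinarith [norm_nonneg (η x)]

theorem integrable_smul_self [SecondCountableTopology V] [NormedSpace ℝ V] {η : V → ℝ} {q : ℝ} (hη : Integrable η μ)
    (hq : Integrable (fun x => ‖x‖ ^ q * η x) μ) (hq1 : 1 ≤ q) :
    Integrable (fun x => η x • x) μ := by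
  have h := integrable_moment_of_le hη hq zero_le_one hq1
  refine h.mono (hη.aestronglyMeasurable.smul aestronglyMeasurable_id) (ae_of_all _ fun x => ?_)
  simp [norm_smul, mul_comm]

theorem integrable_norm_sub_rpow_mul_prod [SecondCountableTopology V] [SFinite μ] {η : V → ℝ} {q : ℝ} (hη : Integrable η μ)
    (hq : Integrable (fun x => ‖x‖ ^ q * η x) μ) (hq0 : 0 ≤ q) :
    Integrable (fun z : V × V => ‖z.1 - z.2‖ ^ q * (η z.1 * η z.2)) (μ.prod μ) := by
  have hm : Measurable fun z : V × V => ‖z.1 - z.2‖ ^ q := by fun_prop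
  refine (((hq.norm.mul_prod hη.norm).add (hη.norm.mul_prod hq.norm)).const_mul (2 ^ q)).mono'
    (hm.aestronglyMeasurable.mul (hη.mul_prod hη).aestronglyMeasurable)
    (ae_of_all _ fun z => ?_)
  have h := norm_sub_rpow_le hq0 z.1 z.2
  simp only [norm_mul, Pi.add_apply, Real.norm_of_nonneg (Real.rpow_nonneg (norm_nonneg _) _)]
  calc _ ≤ 2 ^ q * (‖z.1‖ ^ q + ‖z.2‖ ^ q) * (‖η z.1‖ * ‖η z.2‖) :=
        mul_le_mul_of_nonneg_right h (by positivity)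
    _ = _ := by ring

end Moments

/-! ### Positivity of the Riesz form and of the form of `‖x - y‖ ^ q` -/

section PowerForms

variable {V : Type*} [NormedAddCommGroup V] [InnerProductSpace ℝ V] [FiniteDimensional ℝ V]
  [MeasurableSpace V] [BorelSpace V]

/-- In polar coordinates the integrand becomes `r ^ (dim V - 1 + p)` on `(0, 1]`, whose exponent
exceeds `-1`. -/
theorem integrable_indicator_norm_rpow [Nontrivial V] {p : ℝ}
    (hp : -(Module.finrank ℝ V : ℝ) < p) :
    Integrable fun x : V => (Iic (1 : ℝ)).indicator (fun r => r ^ p) ‖x‖ := by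
  rw [integrable_fun_norm_addHaar]
  have h1 : IntegrableOn (fun y : ℝ => y ^ ((Module.finrank ℝ V : ℝ) - 1 + p)) (Ioc 0 1) := by
    rw [← intervalIntegrable_iff_integrableOn_Ioc_of_le zero_le_one]
    exact intervalIntegral.intervalIntegrable_rpow' (by linarith)
  have h2 : IntegrableOn
      ((Iic (1 : ℝ)).indicator fun y : ℝ => y ^ ((Module.finrank ℝ V : ℝ) - 1 + p)) (Ioi 0) := by
    rw [IntegrableOn, integrable_indicator_iff measurableSet_Iic, IntegrableOn,
      Measure.restrict_restrict measurableSet_Iic, inter_comm, Ioi_inter_Iic]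
    exact h1
  refine h2.congr ?_
  filter_upwards [ae_restrict_mem measurableSet_Ioi] with y hy
  have hy0 : 0 < y := hy
  by_cases h : y ∈ Iic (1 : ℝ)
  · rw [indicator_of_mem h, indicator_of_mem h, smul_eq_mul, ← Real.rpow_natCast,
      ← Real.rpow_add hy0, Nat.cast_sub Module.finrank_pos, Nat.cast_one]
  · rw [indicator_of_notMem h, indicator_of_notMem h, smul_zero]

/-- Split at distance `1`. Close pairs: bound one factor by `M` and convolve the other with the
integrable truncated kernel. Distant pairs: the kernel is at most `1`. -/
theorem integrable_riesz_mul_prod [Nontrivial V] {η : V → ℝ} {p M : ℝ} (hη : Integrable η)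
    (hM : ∀ᵐ x, ‖η x‖ ≤ M) (hp : -(Module.finrank ℝ V : ℝ) < p) (hp0 : p < 0) :
    Integrable fun z : V × V => ‖z.1 - z.2‖ ^ p * (η z.1 * η z.2) := by
  have hm : Measurable fun z : V × V => ‖z.1 - z.2‖ ^ p := by fun_prop
  have hconv := hη.norm.convolution_integrand (ContinuousLinearMap.mul ℝ ℝ)
    (integrable_indicator_norm_rpow hp)
  refine ((hconv.const_mul M).add (hη.norm.mul_prod hη.norm)).mono'
    (hm.aestronglyMeasurable.mul (hη.mul_prod hη).aestronglyMeasurable) ?_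
  have hM' : ∀ᵐ z : V × V, ‖η z.1‖ ≤ M :=
    Measure.quasiMeasurePreserving_fst.ae hM
  filter_upwards [hM'] with z hz
  simp only [norm_mul, Pi.add_apply, Real.norm_of_nonneg (Real.rpow_nonneg (norm_nonneg _) _),
    ContinuousLinearMap.mul_apply']
  by_cases h : ‖z.1 - z.2‖ ∈ Iic (1 : ℝ)
  · rw [indicator_of_mem h]
    have h1 : ‖z.1 - z.2‖ ^ p * (‖η z.1‖ * ‖η z.2‖) ≤ ‖z.1 - z.2‖ ^ p * (M * ‖η z.2‖) := by
      gcongr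
    have h2 : 0 ≤ ‖η z.1‖ * ‖η z.2‖ := by positivity
    linarith
  · rw [indicator_of_notMem h, mul_zero, mul_zero, zero_add]
    have h' : 1 ≤ ‖z.1 - z.2‖ := (not_le.1 h).le
    exact mul_le_of_le_one_left (by positivity) (Real.rpow_le_one_of_one_le_of_nonpos h' hp0.le)

theorem ae_norm_sub_pos [Nontrivial V] : ∀ᵐ z : V × V, 0 < ‖z.1 - z.2‖ := by
  have h : volume {z : V × V | z.1 = z.2} = 0 := by
    rw [Measure.volume_eq_prod, Measure.measure_prod_null
      (measurableSet_eq_fun measurable_fst measurable_snd)]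
    refine ae_of_all _ fun x => ?_
    have : Prod.mk x ⁻¹' {z : V × V | z.1 = z.2} = {x} := by ext; simp [eq_comm]
    simp [this]
  refine measure_mono_null (fun z hz => ?_) h
  simpa [sub_eq_zero] using hz

/-- Expanding the square, the two pure terms carry a factor of the mass and the cross term one of
the first moment. -/
theorem integral_norm_sub_sq_mul_prod {η : V → ℝ} (hη : Integrable η)
    (h2 : Integrable fun x => ‖x‖ ^ (2 : ℝ) * η x) (hmass : ∫ x, η x = 0)
    (hmom : ∫ x, η x • x = 0) :
    ∫ z : V × V, ‖z.1 - z.2‖ ^ (2 : ℝ) * (η z.1 * η z.2) = 0 := by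
  have h1 : Integrable fun x => η x • x := integrable_smul_self hη h2 one_le_two
  have hI := integrable_norm_sub_rpow_mul_prod hη h2 zero_le_two
  rw [Measure.volume_eq_prod, integral_prod _ hI]
  have hexp : ∀ x y, ‖x - y‖ ^ (2 : ℝ) * (η x * η y) =
      ‖x‖ ^ 2 * η x * η y - 2 * η x * inner ℝ x (η y • y) + η x * (‖y‖ ^ (2 : ℝ) * η y) := by
    intro x y
    have := norm_sub_sq_real x y
    simp only [Real.rpow_two, inner_smul_right]
    linear_combination (η x * η y) * this
  have hinner : ∀ x, ∫ y, ‖x - y‖ ^ (2 : ℝ) * (η x * η y) =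
      η x * ∫ y, ‖y‖ ^ (2 : ℝ) * η y := by
    intro x
    have hi := h1.const_inner (𝕜 := ℝ) x
    simp only [hexp]
    have ha := hη.const_mul (‖x‖ ^ 2 * η x)
    have hb := hi.const_mul (2 * η x)
    have hab : Integrable fun y => ‖x‖ ^ 2 * η x * η y - 2 * η x * inner ℝ x (η y • y) :=
      ha.sub hb
    rw [integral_add hab (h2.const_mul _), integral_sub ha hb, integral_const_mul,
      integral_const_mul, integral_const_mul, hmass, integral_inner h1, hmom]
    simp
  simp only [hinner]
  rw [integral_mul_const, hmass, zero_mul]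

theorem integrable_riesz_mixture [Nontrivial V] {η : V → ℝ} {p : ℝ} (hp : p < 0)
    (hη : Integrable η)
    (hI : Integrable fun z : V × V => ‖z.1 - z.2‖ ^ p * (η z.1 * η z.2)) :
    Integrable (Function.uncurry fun (z : V × V) (t : ℝ) =>
      t ^ (-p / 2 - 1) * rexp (-t * ‖z.1 - z.2‖ ^ 2) * (η z.1 * η z.2))
      ((volume : Measure (V × V)).prod (volume.restrict (Ioi 0))) := by
  refine integrable_mixture (K := fun z => Real.Gamma (-p / 2) * ‖z.1 - z.2‖ ^ p)
    ?_ ?_ ?_ ?_ (hη.mul_prod hη).aestronglyMeasurable ?_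
  · unfold Function.uncurry
    fun_prop
  · refine fun z => ?_
    filter_upwards [ae_restrict_mem measurableSet_Ioi] with t ht
    have ht0 : 0 < t := ht
    positivity
  · filter_upwards [ae_norm_sub_pos (V := V)] with z hz
    exact integrableOn_rpow_mul_gaussian hp hz
  · filter_upwards [ae_norm_sub_pos (V := V)] with z hz
    exact integral_rpow_mul_gaussian hp hz
  · simp_rw [mul_assoc]
    exact hI.const_mul _

theorem integral_riesz_mul_prod [Nontrivial V] {η : V → ℝ} {p : ℝ} (hp : p < 0)
    (hη : Integrable η)
    (hI : Integrable fun z : V × V => ‖z.1 - z.2‖ ^ p * (η z.1 * η z.2)) :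
    Real.Gamma (-p / 2) * ∫ z : V × V, ‖z.1 - z.2‖ ^ p * (η z.1 * η z.2) =
      ∫ t in Ioi 0, t ^ (-p / 2 - 1) *
        ∫ z : V × V, rexp (-t * ‖z.1 - z.2‖ ^ 2) * (η z.1 * η z.2) := by
  have h := integral_integral_swap (integrable_riesz_mixture hp hη hI)
  rw [← integral_const_mul]
  have h1 : ∀ᵐ z : V × V, ∫ t in Ioi 0, t ^ (-p / 2 - 1) * rexp (-t * ‖z.1 - z.2‖ ^ 2) *
      (η z.1 * η z.2) = Real.Gamma (-p / 2) * (‖z.1 - z.2‖ ^ p * (η z.1 * η z.2)) := by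
    filter_upwards [ae_norm_sub_pos (V := V)] with z hz
    rw [integral_mul_const, integral_rpow_mul_gaussian hp hz, mul_assoc]
  rw [← integral_congr_ae h1, h]
  simp_rw [mul_assoc, integral_const_mul]

/-- The Riesz kernel is positive definite. -/
theorem integral_riesz_mul_prod_nonneg [Nontrivial V] {η : V → ℝ} {p : ℝ} (hp : p < 0)
    (hη : Integrable η)
    (hI : Integrable fun z : V × V => ‖z.1 - z.2‖ ^ p * (η z.1 * η z.2)) :
    0 ≤ ∫ z : V × V, ‖z.1 - z.2‖ ^ p * (η z.1 * η z.2) := by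
  have h := integral_riesz_mul_prod hp hη hI
  have h0 : 0 ≤ ∫ t in Ioi 0, t ^ (-p / 2 - 1) *
      ∫ z : V × V, rexp (-t * ‖z.1 - z.2‖ ^ 2) * (η z.1 * η z.2) :=
    setIntegral_nonneg measurableSet_Ioi fun t ht =>
      mul_nonneg (Real.rpow_nonneg (le_of_lt ht) _) (integral_gaussian_mul_prod_nonneg ht hη)
  rw [← h] at h0
  exact (mul_nonneg_iff_of_pos_left (Real.Gamma_pos_of_pos (by linarith))).1 h0

/-- The Riesz kernel is strictly positive definite. -/
theorem ae_eq_zero_of_integral_riesz_mul_prod [Nontrivial V] {η : V → ℝ} {p : ℝ} (hp : p < 0)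
    (hη : Integrable η)
    (hI : Integrable fun z : V × V => ‖z.1 - z.2‖ ^ p * (η z.1 * η z.2))
    (h0 : ∫ z : V × V, ‖z.1 - z.2‖ ^ p * (η z.1 * η z.2) = 0) : ∀ᵐ x, η x = 0 := by
  have h := integral_riesz_mul_prod hp hη hI
  have hint := (integrable_riesz_mixture hp hη hI).integral_prod_right
  simp only [Function.uncurry, mul_assoc, integral_const_mul] at hint
  have hnn : 0 ≤ᵐ[volume.restrict (Ioi 0)] fun t : ℝ => t ^ (-p / 2 - 1) *
      ∫ z : V × V, rexp (-t * ‖z.1 - z.2‖ ^ 2) * (η z.1 * η z.2) := by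
    filter_upwards [ae_restrict_mem measurableSet_Ioi] with t ht
    exact mul_nonneg (Real.rpow_nonneg (le_of_lt ht) _) (integral_gaussian_mul_prod_nonneg ht hη)
  rw [h0, mul_zero, eq_comm, integral_eq_zero_iff_of_nonneg_ae hnn hint, EventuallyEq,
    ae_restrict_iff' measurableSet_Ioi] at h
  refine ae_eq_zero_of_gaussian_smoothing hη (frequently_atTop.2 fun a => ?_)
  -- The nonnegative `t`-integrand vanishes almost everywhere, hence at some `t` beyond any given
  -- bound `a`.
  have hpos : volume (Ioi (max a 0)) ≠ 0 := by simp
  obtain ⟨t, ht, hzero⟩ : ∃ t ∈ Ioi (max a 0),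
      ∫ z : V × V, rexp (-t * ‖z.1 - z.2‖ ^ 2) * (η z.1 * η z.2) = 0 := by
    by_contra! hcon
    refine hpos (measure_mono_null (fun t ht => ?_) h)
    have ht0 : 0 < t := (le_max_right a 0).trans_lt ht
    simp only [mem_compl_iff, mem_ofPred_eq, mem_Ioi, Pi.zero_apply, not_forall]
    exact ⟨ht0, mul_ne_zero (by positivity) (hcon t ht)⟩
  have ht0 : 0 < t := (le_max_right a 0).trans_lt ht
  have hta : a < t := (le_max_left a 0).trans_lt ht
  exact ⟨2 * t, by linarith, gaussian_smoothing_ae_eq_zero ht0 hη hzero⟩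

/-- In the mixture of `exp (-t r²) - 1 + t r²`, the constant contributes a squared mass and `r²` the
vanishing quadratic form; only nonnegative Gaussian energies remain. -/
theorem integral_norm_sub_rpow_mul_prod_nonneg_of_lt {η : V → ℝ} {q : ℝ} (hq2 : 2 < q)
    (hq4 : q < 4) (hη : Integrable η) (hq : Integrable fun x => ‖x‖ ^ q * η x)
    (hmass : ∫ x, η x = 0) (hmom : ∫ x, η x • x = 0) :
    0 ≤ ∫ z : V × V, ‖z.1 - z.2‖ ^ q * (η z.1 * η z.2) := by
  have h2 := integrable_moment_of_le hη hq zero_le_two hq2.le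
  have hI2 : Integrable fun z : V × V => ‖z.1 - z.2‖ ^ (2 : ℝ) * (η z.1 * η z.2) :=
    integrable_norm_sub_rpow_mul_prod hη h2 zero_le_two
  have hI : Integrable fun z : V × V => ‖z.1 - z.2‖ ^ q * (η z.1 * η z.2) :=
    integrable_norm_sub_rpow_mul_prod hη hq (by linarith)
  have hηη : Integrable fun z : V × V => η z.1 * η z.2 := hη.mul_prod hη
  set C := ∫ s in Ioi 0, s ^ (-q / 2 - 1) * (rexp (-s) - 1 + s) with hC
  have hmix : Integrable (Function.uncurry fun (z : V × V) (t : ℝ) => t ^ (-q / 2 - 1) *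
      (rexp (-t * ‖z.1 - z.2‖ ^ 2) - 1 + t * ‖z.1 - z.2‖ ^ 2) * (η z.1 * η z.2))
      ((volume : Measure (V × V)).prod (volume.restrict (Ioi 0))) := by
    refine integrable_mixture (K := fun z => C * ‖z.1 - z.2‖ ^ q)
      ?_ ?_ ?_ ?_ hηη.aestronglyMeasurable ?_
    · unfold Function.uncurry
      fun_prop
    · refine fun z => ?_
      filter_upwards [ae_restrict_mem measurableSet_Ioi] with t ht
      have := exp_neg_sub_one_add_nonneg (t * ‖z.1 - z.2‖ ^ 2)
      rw [← neg_mul] at this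
      exact mul_nonneg (Real.rpow_nonneg (le_of_lt ht) _) this
    · exact ae_of_all _ fun z => integrableOn_rpow_mul_exp_remainder_sq hq2 hq4 (norm_nonneg _)
    · exact ae_of_all _ fun z => integral_rpow_mul_exp_remainder_sq hq2 (norm_nonneg _)
    · simp_rw [mul_assoc]
      exact hI.const_mul _
  have h := integral_integral_swap hmix
  simp_rw [integral_mul_const, integral_rpow_mul_exp_remainder_sq hq2 (norm_nonneg _),
    ← hC, mul_assoc, integral_const_mul] at h
  have hnn : 0 ≤ ∫ t in Ioi 0, t ^ (-q / 2 - 1) * ∫ z : V × V,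
      (rexp (-t * ‖z.1 - z.2‖ ^ 2) - 1 + t * ‖z.1 - z.2‖ ^ 2) * (η z.1 * η z.2) := by
    refine setIntegral_nonneg measurableSet_Ioi fun t ht =>
      mul_nonneg (Real.rpow_nonneg (le_of_lt ht) _) ?_
    have hexp : ∀ z : V × V,
        (rexp (-t * ‖z.1 - z.2‖ ^ 2) - 1 + t * ‖z.1 - z.2‖ ^ 2) * (η z.1 * η z.2) =
        rexp (-t * ‖z.1 - z.2‖ ^ 2) * (η z.1 * η z.2) - η z.1 * η z.2 +
          t * (‖z.1 - z.2‖ ^ (2 : ℝ) * (η z.1 * η z.2)) := by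
      intro z
      rw [Real.rpow_two]
      ring
    have hg := integrable_gaussian_mul_prod (le_of_lt ht) hη
    have hgη : Integrable fun z : V × V =>
      rexp (-t * ‖z.1 - z.2‖ ^ 2) * (η z.1 * η z.2) - η z.1 * η z.2 := hg.sub hηη
    simp_rw [hexp]
    rw [integral_add hgη (hI2.const_mul t), integral_sub hg hηη, integral_const_mul,
      integral_norm_sub_sq_mul_prod hη h2 hmass hmom, Measure.volume_eq_prod,
      integral_prod_mul, hmass]
    rw [mul_zero, mul_zero, sub_zero, add_zero]
    exact integral_gaussian_mul_prod_nonneg ht hη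
  rw [← h] at hnn
  exact (mul_nonneg_iff_of_pos_left (integral_rpow_mul_exp_remainder_pos hq2 hq4)).1 hnn

/-- For `2 ≤ q ≤ 4` the kernel `‖x - y‖ ^ q` is positive semidefinite on densities with vanishing
mass and vanishing first moment. -/
theorem integral_norm_sub_rpow_mul_prod_nonneg {η : V → ℝ} {q : ℝ} (hq2 : 2 ≤ q)
    (hq4 : q ≤ 4) (hη : Integrable η) (hq : Integrable fun x => ‖x‖ ^ q * η x)
    (hmass : ∫ x, η x = 0) (hmom : ∫ x, η x • x = 0) :
    0 ≤ ∫ z : V × V, ‖z.1 - z.2‖ ^ q * (η z.1 * η z.2) := by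
  rcases hq2.eq_or_lt with rfl | hq2
  · exact (integral_norm_sub_sq_mul_prod hη hq hmass hmom).ge
  have hI : Integrable fun z : V × V => ‖z.1 - z.2‖ ^ q * (η z.1 * η z.2) :=
    integrable_norm_sub_rpow_mul_prod hη hq (by linarith)
  have hηη : Integrable fun z : V × V => η z.1 * η z.2 := hη.mul_prod hη
  -- Exponents `s < q` stay strictly below `4`, so letting `s` increase to `q` covers `q = 4`; `1 +
  -- r ^ q` dominates `r ^ s`.
  have hev : ∀ᶠ s in 𝓝[<] q, s ∈ Ioo 2 q := Ioo_mem_nhdsLT hq2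
  have hlim : Tendsto (fun s => ∫ z : V × V, ‖z.1 - z.2‖ ^ s * (η z.1 * η z.2)) (𝓝[<] q)
      (𝓝 (∫ z : V × V, ‖z.1 - z.2‖ ^ q * (η z.1 * η z.2))) := by
    refine tendsto_integral_filter_of_dominated_convergence
      (fun z => ‖η z.1 * η z.2‖ + ‖‖z.1 - z.2‖ ^ q * (η z.1 * η z.2)‖) ?_ ?_
      (hηη.norm.add hI.norm) (ae_of_all _ fun z => ?_)
    · refine Eventually.of_forall fun s => ?_
      have hm : Measurable fun z : V × V => ‖z.1 - z.2‖ ^ s := by fun_prop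
      exact hm.aestronglyMeasurable.mul hηη.aestronglyMeasurable
    · filter_upwards [hev] with s hs
      refine ae_of_all _ fun z => ?_
      have h := rpow_le_one_add_rpow (norm_nonneg (z.1 - z.2)) (by linarith [hs.1] : 0 ≤ s) hs.2.le
      simp only [norm_mul, Real.norm_of_nonneg (Real.rpow_nonneg (norm_nonneg _) _)]
      have : 0 ≤ ‖η z.1‖ * ‖η z.2‖ := by positivity
      nlinarith
    · refine Tendsto.mul_const _ ?_
      exact ((Real.continuousAt_const_rpow' (by linarith)).tendsto).mono_left nhdsWithin_le_nhds
  refine ge_of_tendsto hlim ?_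
  filter_upwards [hev] with s hs
  exact integral_norm_sub_rpow_mul_prod_nonneg_of_lt hs.1 (hs.2.trans_le hq4) hη
    (integrable_moment_of_le hη hq (by linarith [hs.1]) hs.2.le) hmass hmom

end PowerForms

/-! ### From invariance under isometries to a radial profile -/

section Radial

variable {V : Type*} [NormedAddCommGroup V] [InnerProductSpace ℝ V] [FiniteDimensional ℝ V]
  [MeasurableSpace V] [BorelSpace V]

/-- The reflection in the hyperplane orthogonal to `x - y` carries one ball to the other and
preserves both measure and `u`. -/
theorem average_closedBall_eq_of_norm_eq {u : V → ℝ}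
    (hu : ∀ R : V ≃ₗᵢ[ℝ] V, ∀ᵐ x, u (R x) = u x) {x y : V} (hxy : ‖x‖ = ‖y‖) (r : ℝ) :
    ⨍ z in Metric.closedBall x r, u z = ⨍ z in Metric.closedBall y r, u z := by
  obtain ⟨R, hR⟩ : ∃ R : V ≃ₗᵢ[ℝ] V, R x = y :=
    ⟨(ℝ ∙ (x - y))ᗮ.reflection, Submodule.reflection_sub hxy⟩
  have hpre : R ⁻¹' Metric.closedBall y r = Metric.closedBall x r := by
    rw [← hR, LinearIsometryEquiv.preimage_closedBall, R.symm_apply_apply]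
  have h := R.measurePreserving.setIntegral_preimage_emb
    R.toMeasurableEquiv.measurableEmbedding u (Metric.closedBall y r)
  rw [hpre] at h
  rw [setAverage_eq, setAverage_eq, ← h, measureReal_def, measureReal_def,
    Measure.addHaar_closedBall_center volume x, Measure.addHaar_closedBall_center volume y]
  congr 1
  refine setIntegral_congr_ae Metric.isClosed_closedBall.measurableSet ?_
  filter_upwards [hu R] with z hz _
  exact hz.symm

/-- A locally integrable function invariant under every linear isometry up to null sets is almost
everywhere a function of the norm. -/
theorem exists_ae_eq_comp_norm [Nontrivial V] {u : V → ℝ} (hloc : LocallyIntegrable u)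
    (hu : ∀ R : V ≃ₗᵢ[ℝ] V, ∀ᵐ x, u (R x) = u x) : ∃ f : ℝ → ℝ, ∀ᵐ x, u x = f ‖x‖ := by
  obtain ⟨e, he⟩ := exists_norm_eq V zero_le_one
  -- The profile at `r` is the limit of averages over balls shrinking to `r • e`. These averages
  -- depend only on the norm of the center, and by Lebesgue differentiation those at `x` tend to `u
  -- x` for almost every `x`.
  refine ⟨fun r => limUnder atTop fun j : ℕ =>
    ⨍ z in Metric.closedBall (r • e) (1 / ((j : ℝ) + 1)), u z, ?_⟩
  filter_upwards [IsUnifLocDoublingMeasure.ae_tendsto_average volume hloc 1] with x hx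
  have hδ : Tendsto (fun j : ℕ => 1 / ((j : ℝ) + 1)) atTop (𝓝[>] 0) :=
    tendsto_nhdsWithin_iff.2 ⟨tendsto_one_div_add_atTop_nhds_zero_nat,
      Eventually.of_forall fun j => by simp only [mem_Ioi]; positivity⟩
  have h := hx (fun _ => x) _ hδ (Eventually.of_forall fun j => by
    simp only [Metric.mem_closedBall, dist_self]; positivity)
  rw [← h.limUnder_eq]
  congr 1
  funext j
  exact average_closedBall_eq_of_norm_eq hu (by simp [norm_smul, he]) _

end Radial

/-! ### Densities with finite moments -/

/-- Bounded integrable functions with a finite absolute moment of order `q`. -/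
structure HasBoundedMoment {V : Type*} [NormedAddCommGroup V] [MeasureSpace V] (q : ℝ)
    (η : V → ℝ) : Prop where
  integrable : Integrable η
  bounded : ∃ M, ∀ᵐ x, ‖η x‖ ≤ M
  moment : Integrable fun x => ‖x‖ ^ q * η x

namespace HasBoundedMoment

variable {V : Type*} [NormedAddCommGroup V] [MeasureSpace V] {q : ℝ} {η ζ : V → ℝ}

theorem add (hη : HasBoundedMoment q η) (hζ : HasBoundedMoment q ζ) :
    HasBoundedMoment q fun x => η x + ζ x := by
  obtain ⟨M, hM⟩ := hη.bounded
  obtain ⟨N, hN⟩ := hζ.bounded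
  refine ⟨hη.integrable.add hζ.integrable, ⟨M + N, ?_⟩, ?_⟩
  · filter_upwards [hM, hN] with x h1 h2
    exact (norm_add_le _ _).trans (add_le_add h1 h2)
  · simp_rw [mul_add]
    exact hη.moment.add hζ.moment

theorem const_mul (c : ℝ) (hη : HasBoundedMoment q η) : HasBoundedMoment q fun x => c * η x := by
  obtain ⟨M, hM⟩ := hη.bounded
  refine ⟨hη.integrable.const_mul c, ⟨‖c‖ * M, ?_⟩, ?_⟩
  · filter_upwards [hM] with x h1
    rw [norm_mul]
    gcongr
  · simp_rw [mul_left_comm _ c]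
    exact hη.moment.const_mul c

theorem sub (hη : HasBoundedMoment q η) (hζ : HasBoundedMoment q ζ) :
    HasBoundedMoment q fun x => η x - ζ x := by
  simpa [sub_eq_add_neg] using hη.add (hζ.const_mul (-1))

end HasBoundedMoment

/-! ### The energy and its minimizers -/

section Energy

variable {n : ℕ} {p q m M : ℝ}

theorem measurable_kernel : Measurable (kernel p q : EuclideanSpace ℝ (Fin n) → ℝ) := by
  unfold kernel
  fun_prop

theorem nontrivial_of_neg_lt (hpn : -(n : ℝ) < p) (hp0 : p < 0) :
    Nontrivial (EuclideanSpace ℝ (Fin n)) := by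
  have hn : 0 < n := by
    have : (0 : ℝ) < n := by linarith
    exact_mod_cast this
  exact Module.nontrivial_of_finrank_pos (R := ℝ) (by simpa using hn)

theorem kernel_mul_eq (x : EuclideanSpace ℝ (Fin n)) (s : ℝ) :
    kernel p q x * s = q⁻¹ * (‖x‖ ^ q * s) + (-p)⁻¹ * (‖x‖ ^ p * s) := by
  rw [kernel, inv_neg]
  ring

variable {η u v : EuclideanSpace ℝ (Fin n) → ℝ}

theorem integrable_norm_rpow_parts (hpn : -(n : ℝ) < p) (hp0 : p < 0) (hq : 0 ≤ q)
    (hη : HasBoundedMoment q η) :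
    (Integrable fun z : EuclideanSpace ℝ (Fin n) × EuclideanSpace ℝ (Fin n) =>
      ‖z.1 - z.2‖ ^ q * (η z.1 * η z.2)) ∧
    Integrable fun z : EuclideanSpace ℝ (Fin n) × EuclideanSpace ℝ (Fin n) =>
      ‖z.1 - z.2‖ ^ p * (η z.1 * η z.2) := by
  have := nontrivial_of_neg_lt hpn hp0
  obtain ⟨M, hM⟩ := hη.bounded
  exact ⟨integrable_norm_sub_rpow_mul_prod hη.integrable hη.moment hq,
    integrable_riesz_mul_prod hη.integrable hM (by simpa using hpn) hp0⟩

theorem integrable_kernel_mul_prod (hpn : -(n : ℝ) < p) (hp0 : p < 0) (hq : 0 ≤ q)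
    (hη : HasBoundedMoment q η) :
    Integrable fun z : EuclideanSpace ℝ (Fin n) × EuclideanSpace ℝ (Fin n) =>
      kernel p q (z.1 - z.2) * (η z.1 * η z.2) := by
  obtain ⟨h1, h2⟩ := integrable_norm_rpow_parts hpn hp0 hq hη
  simp_rw [kernel_mul_eq]
  exact (h1.const_mul _).add (h2.const_mul _)

/-- The interaction form is positive definite on densities with vanishing mass and vanishing first
moment. -/
theorem ae_eq_zero_of_kernel_form_nonpos (hpn : -(n : ℝ) < p) (hp0 : p < 0) (hq2 : 2 ≤ q)
    (hq4 : q ≤ 4) (hη : HasBoundedMoment q η) (hmass : ∫ x, η x = 0) (hmom : ∫ x, η x • x = 0)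
    (hform : ∫ z : EuclideanSpace ℝ (Fin n) × EuclideanSpace ℝ (Fin n),
      kernel p q (z.1 - z.2) * (η z.1 * η z.2) ≤ 0) : ∀ᵐ x, η x = 0 := by
  have := nontrivial_of_neg_lt hpn hp0
  obtain ⟨h1, h2⟩ := integrable_norm_rpow_parts hpn hp0 (by linarith) hη
  simp_rw [kernel_mul_eq] at hform
  rw [integral_add (h1.const_mul _) (h2.const_mul _), integral_const_mul,
    integral_const_mul] at hform
  have hA := integral_norm_sub_rpow_mul_prod_nonneg hq2 hq4 hη.integrable hη.moment hmass hmom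
  have hB := integral_riesz_mul_prod_nonneg hp0 hη.integrable h2
  have hq' : 0 ≤ q⁻¹ := by positivity
  have hp' : 0 < (-p)⁻¹ := inv_pos.2 (by linarith)
  refine ae_eq_zero_of_integral_riesz_mul_prod hp0 hη.integrable h2 (le_antisymm ?_ hB)
  have := mul_nonneg hq' hA
  exact nonpos_of_mul_nonpos_right (by linarith) hp'

theorem ae_prod_nonneg (hu : ∀ᵐ x, 0 ≤ u x) :
    ∀ᵐ z : EuclideanSpace ℝ (Fin n) × EuclideanSpace ℝ (Fin n), 0 ≤ u z.1 ∧ 0 ≤ u z.2 :=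
  (Measure.quasiMeasurePreserving_fst.ae hu).and (Measure.quasiMeasurePreserving_snd.ae hu)

theorem energy_eq_ofReal (hpn : -(n : ℝ) < p) (hp0 : p < 0) (hq : 0 < q)
    (hu : HasBoundedMoment q u) (hu0 : ∀ᵐ x, 0 ≤ u x) :
    energy p q u = ENNReal.ofReal (∫ z : EuclideanSpace ℝ (Fin n) × EuclideanSpace ℝ (Fin n),
      kernel p q (z.1 - z.2) * (u z.1 * u z.2)) := by
  rw [ofReal_integral_eq_lintegral_ofReal (integrable_kernel_mul_prod hpn hp0 hq.le hu)]
  · simp_rw [energy, mul_assoc]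
  · filter_upwards [ae_prod_nonneg hu0] with z hz
    exact mul_nonneg (kernel_nonneg hp0 hq _) (mul_nonneg hz.1 hz.2)

/-- The kernel dominates `‖x - y‖ ^ q / q`. By Fubini some slice at a point `x` with `u x ≠ 0` is
integrable, giving a finite moment about `x`; the triangle inequality moves its center to the
origin. -/
theorem hasBoundedMoment_of_energy_ne_top (hp0 : p < 0) (hq : 0 < q) (hm : 0 < m)
    (hu : u ∈ admissible n m M) (hE : energy p q u ≠ ⊤) : HasBoundedMoment q u := by
  obtain ⟨hint, hu0, huM, hmass⟩ := hu
  refine ⟨hint, ⟨M, ?_⟩, ?_⟩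
  · filter_upwards [hu0, huM] with x h1 h2
    rwa [Real.norm_of_nonneg h1]
  have hprod : Integrable fun z : EuclideanSpace ℝ (Fin n) × EuclideanSpace ℝ (Fin n) =>
    u z.1 * u z.2 := hint.mul_prod hint
  have hmeas : Measurable fun z : EuclideanSpace ℝ (Fin n) × EuclideanSpace ℝ (Fin n) =>
    kernel p q (z.1 - z.2) := measurable_kernel.comp (measurable_fst.sub measurable_snd)
  have hF : Integrable fun z : EuclideanSpace ℝ (Fin n) × EuclideanSpace ℝ (Fin n) =>
      kernel p q (z.1 - z.2) * (u z.1 * u z.2) := by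
    refine ⟨hmeas.aestronglyMeasurable.mul hprod.aestronglyMeasurable, ?_⟩
    rw [hasFiniteIntegral_iff_ofReal]
    · simpa only [energy, mul_assoc] using lt_top_iff_ne_top.2 hE
    · filter_upwards [ae_prod_nonneg hu0] with z hz
      exact mul_nonneg (kernel_nonneg hp0 hq _) (mul_nonneg hz.1 hz.2)
  have hG : Integrable fun z : EuclideanSpace ℝ (Fin n) × EuclideanSpace ℝ (Fin n) =>
      ‖z.1 - z.2‖ ^ q * (u z.1 * u z.2) := by
    have hm' : Measurable fun z : EuclideanSpace ℝ (Fin n) × EuclideanSpace ℝ (Fin n) =>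
      ‖z.1 - z.2‖ ^ q := by fun_prop
    refine (hF.const_mul q).mono' (hm'.aestronglyMeasurable.mul hprod.aestronglyMeasurable) ?_
    filter_upwards [ae_prod_nonneg hu0] with z hz
    have hzz := mul_nonneg hz.1 hz.2
    rw [Real.norm_of_nonneg (mul_nonneg (by positivity) hzz), kernel_mul_eq, mul_add,
      mul_inv_cancel_left₀ hq.ne']
    have : 0 ≤ q * ((-p)⁻¹ * (‖z.1 - z.2‖ ^ p * (u z.1 * u z.2))) := by
      have : 0 < -p := by linarith
      positivity
    linarith
  obtain ⟨x, hx, hGx⟩ : ∃ x, u x ≠ 0 ∧ Integrable fun y => ‖x - y‖ ^ q * (u x * u y) := by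
    by_contra! hcon
    refine hm.ne' (hmass.symm.trans (integral_eq_zero_of_ae ?_))
    filter_upwards [hG.prod_right_ae] with x hx
    by_contra hne
    exact hcon x hne hx
  have hGx' : Integrable fun y => ‖x - y‖ ^ q * u y := by
    refine (hGx.const_mul (u x)⁻¹).congr (ae_of_all _ fun y => ?_)
    field_simp
  have hm' : Measurable fun y : EuclideanSpace ℝ (Fin n) => ‖y‖ ^ q := by fun_prop
  refine (((hint.norm.const_mul (‖x‖ ^ q)).add hGx'.norm).const_mul (2 ^ q)).mono'
    (hm'.aestronglyMeasurable.mul hint.aestronglyMeasurable) (ae_of_all _ fun y => ?_)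
  have h := norm_sub_rpow_le hq.le x (x - y)
  rw [sub_sub_cancel] at h
  simp only [norm_mul, Pi.add_apply, Real.norm_of_nonneg (Real.rpow_nonneg (norm_nonneg _) _)]
  calc _ ≤ 2 ^ q * (‖x‖ ^ q + ‖x - y‖ ^ q) * ‖u y‖ := mul_le_mul_of_nonneg_right h (norm_nonneg _)
    _ = _ := by ring

/-- A constant density on a large ball; it shows that minimizers have finite energy. -/
theorem exists_admissible_hasBoundedMoment [Nontrivial (EuclideanSpace ℝ (Fin n))] (hq : 0 ≤ q)
    (hm : 0 < m) (hM : 0 < M) : ∃ w ∈ admissible n m M, HasBoundedMoment q w := by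
  set B := volume.real (Metric.ball (0 : EuclideanSpace ℝ (Fin n)) 1) with hB
  have hB0 : 0 < B := ENNReal.toReal_pos (Metric.measure_ball_pos _ _ one_pos).ne'
    measure_ball_lt_top.ne
  -- `R ≥ 1` gives `R ≤ R ^ n`, so the ball of radius `R` has volume at least `m / M`.
  set R := max 1 (m / (M * B)) with hR
  have hR1 : 1 ≤ R := le_max_left _ _
  set S := Metric.ball (0 : EuclideanSpace ℝ (Fin n)) R with hS
  have hSm : MeasurableSet S := Metric.isOpen_ball.measurableSet
  have hSfin : volume S ≠ ⊤ := measure_ball_lt_top.ne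
  have hvol : volume.real S = R ^ n * B := by
    rw [hS, measureReal_def, Measure.addHaar_ball _ _ (by linarith), ENNReal.toReal_mul,
      ENNReal.toReal_ofReal (by positivity), finrank_euclideanSpace_fin]
    rfl
  have hV0 : 0 < volume.real S := by rw [hvol]; positivity
  have hn : n ≠ 0 := by
    have := Module.finrank_pos (R := ℝ) (M := EuclideanSpace ℝ (Fin n))
    rw [finrank_euclideanSpace_fin] at this
    exact this.ne'
  have hcM : m / volume.real S ≤ M := by
    rw [div_le_iff₀ hV0, hvol]
    have h1 : m / (M * B) ≤ R ^ n := (le_max_right _ _).trans (le_self_pow₀ hR1 hn)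
    rw [div_le_iff₀ (by positivity)] at h1
    linarith
  have hc0 : 0 ≤ m / volume.real S := by positivity
  have hint : Integrable (S.indicator fun _ => m / volume.real S) :=
    (integrable_indicator_iff hSm).2 (integrableOn_const hSfin)
  refine ⟨S.indicator fun _ => m / volume.real S, ⟨hint, ?_, ?_, ?_⟩, hint, ⟨M, ?_⟩, ?_⟩
  · exact ae_of_all _ fun x => indicator_nonneg (fun _ _ => hc0) x
  · exact ae_of_all _ fun x => indicator_le' (fun _ _ => hcM) (fun _ _ => hM.le) x
  · rw [integral_indicator hSm, setIntegral_const, smul_eq_mul, mul_div_cancel₀ _ hV0.ne']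
  · refine ae_of_all _ fun x => ?_
    rw [Real.norm_of_nonneg (indicator_nonneg (fun _ _ => hc0) x)]
    exact indicator_le' (fun _ _ => hcM) (fun _ _ => hM.le) x
  · have hm' : Measurable fun y : EuclideanSpace ℝ (Fin n) => ‖y‖ ^ q := by fun_prop
    refine (hint.norm.const_mul (R ^ q)).mono'
      (hm'.aestronglyMeasurable.mul hint.aestronglyMeasurable) (ae_of_all _ fun x => ?_)
    rw [norm_mul, Real.norm_of_nonneg (Real.rpow_nonneg (norm_nonneg x) q)]
    by_cases hx : x ∈ S
    · have : ‖x‖ < R := by simpa [hS] using hx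
      gcongr
    · simp [indicator_of_notMem hx]

theorem IsMinimizer.energy_ne_top (hpn : -(n : ℝ) < p) (hp0 : p < 0) (hq : 0 < q)
    (hm : 0 < m) (hM : 0 < M) (hu : IsMinimizer p q m M u) : energy p q u ≠ ⊤ := by
  have := nontrivial_of_neg_lt hpn hp0
  obtain ⟨w, hw, hwb⟩ := exists_admissible_hasBoundedMoment (n := n) hq.le hm hM
  refine ne_top_of_le_ne_top ?_ (hu.2 w hw)
  rw [energy_eq_ofReal hpn hp0 hq hwb hw.2.1]
  exact ENNReal.ofReal_ne_top

theorem IsMinimizer.hasBoundedMoment (hpn : -(n : ℝ) < p) (hp0 : p < 0) (hq : 0 < q)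
    (hm : 0 < m) (hM : 0 < M) (hu : IsMinimizer p q m M u) : HasBoundedMoment q u :=
  hasBoundedMoment_of_energy_ne_top hp0 hq hm hu.1 (hu.energy_ne_top hpn hp0 hq hm hM)

/-- Two minimizers with the same first moment agree almost everywhere. -/
theorem IsMinimizer.ae_eq_of_moment_eq (hpn : -(n : ℝ) < p) (hp0 : p < 0) (hq2 : 2 ≤ q)
    (hq4 : q ≤ 4) (hm : 0 < m) (hM : 0 < M) (hu : IsMinimizer p q m M u)
    (hv : IsMinimizer p q m M v) (hmom : ∫ x, u x • x = ∫ x, v x • x) : ∀ᵐ x, u x = v x := by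
  have hq : 0 < q := by linarith
  have hub := hu.hasBoundedMoment hpn hp0 hq hm hM
  have hvb := hv.hasBoundedMoment hpn hp0 hq hm hM
  have hwb : HasBoundedMoment q fun x => 2⁻¹ * (u x + v x) := (hub.add hvb).const_mul _
  have hηb : HasBoundedMoment q fun x => u x - v x := hub.sub hvb
  obtain ⟨⟨hui, hu0, huM, hum⟩, humin⟩ := hu
  obtain ⟨⟨hvi, hv0, hvM, hvm⟩, hvmin⟩ := hv
  have hw0 : ∀ᵐ x, 0 ≤ 2⁻¹ * (u x + v x) := by
    filter_upwards [hu0, hv0] with x h1 h2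
    positivity
  have hw : (fun x => 2⁻¹ * (u x + v x)) ∈ admissible n m M := by
    refine ⟨hwb.integrable, hw0, ?_, ?_⟩
    · filter_upwards [huM, hvM] with x h1 h2
      linarith
    · rw [integral_const_mul, integral_add hui hvi, hum, hvm]
      ring
  have huw := humin _ hw
  have hvw := hvmin _ hw
  have hFw0 : 0 ≤ ∫ z : EuclideanSpace ℝ (Fin n) × EuclideanSpace ℝ (Fin n),
      kernel p q (z.1 - z.2) * (2⁻¹ * (u z.1 + v z.1) * (2⁻¹ * (u z.2 + v z.2))) := by
    refine integral_nonneg_of_ae ?_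
    filter_upwards [ae_prod_nonneg hw0] with z hz
    exact mul_nonneg (kernel_nonneg hp0 hq _) (mul_nonneg hz.1 hz.2)
  rw [energy_eq_ofReal hpn hp0 hq hwb hw0] at huw hvw
  rw [energy_eq_ofReal hpn hp0 hq hub hu0, ENNReal.ofReal_le_ofReal_iff hFw0] at huw
  rw [energy_eq_ofReal hpn hp0 hq hvb hv0, ENNReal.ofReal_le_ofReal_iff hFw0] at hvw
  have hFw := integrable_kernel_mul_prod hpn hp0 hq.le hwb
  have hFη := integrable_kernel_mul_prod hpn hp0 hq.le hηb
  have hFu := integrable_kernel_mul_prod hpn hp0 hq.le hub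
  have hFv := integrable_kernel_mul_prod hpn hp0 hq.le hvb
  -- Parallelogram identity for the form. Neither minimizer has more energy than the midpoint, so
  -- the form of `u - v` is at most zero.
  have hpar : (∫ z : EuclideanSpace ℝ (Fin n) × EuclideanSpace ℝ (Fin n),
      kernel p q (z.1 - z.2) * (2⁻¹ * (u z.1 + v z.1) * (2⁻¹ * (u z.2 + v z.2)))) +
      4⁻¹ * ∫ z : EuclideanSpace ℝ (Fin n) × EuclideanSpace ℝ (Fin n),
        kernel p q (z.1 - z.2) * ((u z.1 - v z.1) * (u z.2 - v z.2)) =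
      2⁻¹ * ((∫ z : EuclideanSpace ℝ (Fin n) × EuclideanSpace ℝ (Fin n),
        kernel p q (z.1 - z.2) * (u z.1 * u z.2)) +
      ∫ z : EuclideanSpace ℝ (Fin n) × EuclideanSpace ℝ (Fin n),
        kernel p q (z.1 - z.2) * (v z.1 * v z.2)) := by
    rw [← integral_const_mul, ← integral_add hFw (hFη.const_mul _), ← integral_add hFu hFv,
      ← integral_const_mul]
    congr 1
    funext z
    ring
  have hiu := integrable_smul_self hui hub.moment (by linarith)
  have hiv := integrable_smul_self hvi hvb.moment (by linarith)
  have h := ae_eq_zero_of_kernel_form_nonpos hpn hp0 hq2 hq4 hηb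
    (by rw [integral_sub hui hvi, hum, hvm, sub_self])
    (by simp_rw [sub_smul]; rw [integral_sub hiu hiv, hmom, sub_self]) (by linarith)
  filter_upwards [h] with x hx
  exact sub_eq_zero.1 hx

theorem energy_comp_isometry (T : EuclideanSpace ℝ (Fin n) ≃ᵐ EuclideanSpace ℝ (Fin n))
    (hT : MeasurePreserving T) (hiso : Isometry T) (u : EuclideanSpace ℝ (Fin n) → ℝ) :
    energy p q (fun x => u (T x)) = energy p q u := by
  have hTT : MeasurePreserving (T.prodCongr T)
      (volume : Measure (EuclideanSpace ℝ (Fin n) × EuclideanSpace ℝ (Fin n))) volume :=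
    hT.prod hT
  unfold energy
  rw [← hTT.lintegral_comp_emb (T.prodCongr T).measurableEmbedding
    fun z => ENNReal.ofReal (kernel p q (z.1 - z.2) * u z.1 * u z.2)]
  refine lintegral_congr fun z => ?_
  have hz : ‖T z.1 - T z.2‖ = ‖z.1 - z.2‖ := by
    rw [← dist_eq_norm, hiso.dist_eq, dist_eq_norm]
  have hk : kernel p q (z.1 - z.2) = kernel p q (T z.1 - T z.2) := by
    rw [kernel, kernel, hz]
  rw [hk]
  rfl

theorem IsMinimizer.comp_isometry (hu : IsMinimizer p q m M u)
    (T : EuclideanSpace ℝ (Fin n) ≃ᵐ EuclideanSpace ℝ (Fin n))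
    (hT : MeasurePreserving T) (hiso : Isometry T) :
    IsMinimizer p q m M fun x => u (T x) := by
  obtain ⟨⟨hui, hu0, huM, hum⟩, humin⟩ := hu
  refine ⟨⟨hT.integrable_comp_of_integrable hui, hT.quasiMeasurePreserving.ae hu0,
    hT.quasiMeasurePreserving.ae huM, ?_⟩, fun w hw => ?_⟩
  · rw [hT.integral_comp T.measurableEmbedding, hum]
  · rw [energy_comp_isometry T hT hiso]
    exact humin w hw

theorem IsMinimizer.comp_add_right (hu : IsMinimizer p q m M u) (c : EuclideanSpace ℝ (Fin n)) :
    IsMinimizer p q m M fun x => u (x + c) :=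
  hu.comp_isometry (MeasurableEquiv.addRight c) (measurePreserving_add_right volume c)
    (isometry_add_right c)

theorem IsMinimizer.comp_linearIsometryEquiv (hu : IsMinimizer p q m M u)
    (R : EuclideanSpace ℝ (Fin n) ≃ₗᵢ[ℝ] EuclideanSpace ℝ (Fin n)) :
    IsMinimizer p q m M fun x => u (R x) :=
  hu.comp_isometry R.toMeasurableEquiv R.measurePreserving R.isometry

/-- Translating the center of mass to the origin makes the first moment vanish. -/
theorem integral_comp_add_center_smul (hm : m ≠ 0) (hui : Integrable u)
    (hum : ∫ x, u x = m) (hmom : Integrable fun x => u x • x) :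
    ∫ x, u (x + m⁻¹ • ∫ y, u y • y) • x = 0 := by
  set c := m⁻¹ • ∫ y, u y • y with hc
  have h1 : ∀ x, u (x + c) • x = u (x + c) • (x + c) - u (x + c) • c := fun x => by
    rw [smul_add, add_sub_cancel_right]
  simp_rw [h1]
  rw [integral_add_right_eq_self (fun x => u x • x - u x • c), integral_sub hmom
    (hui.smul_const c), integral_smul_const, hum, hc, smul_inv_smul₀ hm, sub_self]

end Energy

end NonlocalMin

/-! ### Uniqueness up to translation and radial symmetry -/

theorem theorem1p1 (n : ℕ) (p q m M : ℝ) (hq2 : 2 ≤ q) (hq4 : q ≤ 4)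
    (hpn : -(n : ℝ) < p) (hp0 : p < 0) (hm : 0 < m) (hM : 0 < M) :
    (∀ u v : EuclideanSpace ℝ (Fin n) → ℝ,
      NonlocalMin.IsMinimizer p q m M u → NonlocalMin.IsMinimizer p q m M v →
        ∃ a : EuclideanSpace ℝ (Fin n), ∀ᵐ x, v x = u (x - a)) ∧
    (∀ u : EuclideanSpace ℝ (Fin n) → ℝ, NonlocalMin.IsMinimizer p q m M u →
      Integrable (fun x => u x • x) ∧
        NonlocalMin.IsRadialAbout (m⁻¹ • ∫ x, u x • x) u) := by
  have := NonlocalMin.nontrivial_of_neg_lt hpn hp0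
  have hmom : ∀ u : EuclideanSpace ℝ (Fin n) → ℝ, NonlocalMin.IsMinimizer p q m M u →
      Integrable (fun x => u x • x) := fun u hu =>
    NonlocalMin.integrable_smul_self hu.1.1
      (hu.hasBoundedMoment hpn hp0 (by linarith) hm hM).moment (by linarith)
  have hcenter : ∀ u : EuclideanSpace ℝ (Fin n) → ℝ, NonlocalMin.IsMinimizer p q m M u →
      ∫ x, u (x + m⁻¹ • ∫ y, u y • y) • x = 0 := fun u hu =>
    NonlocalMin.integral_comp_add_center_smul hm.ne' hu.1.1 hu.1.2.2.2 (hmom u hu)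
  have hshift : ∀ (c : EuclideanSpace ℝ (Fin n)) {P : EuclideanSpace ℝ (Fin n) → Prop},
      (∀ᵐ x, P x) → ∀ᵐ x, P (x - c) := fun c _ h =>
    (measurePreserving_sub_right volume c).quasiMeasurePreserving.ae h
  refine ⟨fun u v hu hv => ?_, fun u hu => ⟨hmom u hu, ?_⟩⟩
  · set c := m⁻¹ • ∫ y, u y • y
    set d := m⁻¹ • ∫ y, v y • y
    have h := (hv.comp_add_right d).ae_eq_of_moment_eq hpn hp0 hq2 hq4 hm hM
      (hu.comp_add_right c) ((hcenter v hv).trans (hcenter u hu).symm)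
    -- The centered minimizers agree, `v (x + d) = u (x + c)`; replace `x` by `x - d`.
    refine ⟨d - c, ?_⟩
    filter_upwards [hshift d h] with x hx
    rw [sub_add_cancel] at hx
    rw [hx]
    congr 1
    abel
  · set c := m⁻¹ • ∫ y, u y • y
    have hu' := hu.comp_add_right c
    obtain ⟨f, hf⟩ := NonlocalMin.exists_ae_eq_comp_norm hu'.1.1.locallyIntegrable fun R => by
      refine (hu'.comp_linearIsometryEquiv R).ae_eq_of_moment_eq hpn hp0 hq2 hq4 hm hM hu' ?_
      -- Changing variables, the first moment of the rotated function is `R.symm` applied to that of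
      -- the centered minimizer, hence zero.
      have h := R.measurePreserving.integral_comp R.toMeasurableEquiv.measurableEmbedding
        (fun y => u (y + c) • R.symm y)
      simp only [LinearIsometryEquiv.symm_apply_apply] at h
      rw [h, hcenter u hu]
      simp_rw [← map_smul]
      have h2 := R.symm.toContinuousLinearEquiv.integral_comp_comm (μ := volume)
        fun y => u (y + c) • y
      simp only [LinearIsometryEquiv.coe_toContinuousLinearEquiv] at h2
      rw [h2, hcenter u hu, map_zero]
    refine ⟨f, ?_⟩
    filter_upwards [hshift c hf] with x hx
    rwa [sub_add_cancel] at hx
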